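/- Let $G$ be a finite simple graph with $n$ vertices and $m\ge 1$ edges. Let $M_1=\sum_{v} d(v)^2$ be its first Zagreb index, let $q_1\ge\dots\ge q_n$ be the eigenvalues (with multiplicity) of its signless Laplacian matrix $Q(G)=D(G)+A(G)$, where $D(G)$ is the diagonal matrix of vertex degrees and $A(G)$ the adjacency matrix, and let $QE(G)=\sum_{i=1}^n\left|q_i-\frac{2m}{n}\right|$ be the signless Laplacian energy of $G$. (1) If $n\le \frac{8m^2}{2m+M_1}$, then $$QE(G)\le \frac{2m}{n}+\sqrt{(n-1)\left[2m+M_1-\frac{4m^2}{n}-\left(\frac{2m}{n}\right)^2\right]},$$ with equality if and only if $G\cong K_n$, or $n$ is even and $G\cong\frac n2K_2$ (the disjoint union of $\frac n2$ copies of $K_2$), or $G$ is, for some $r$, an $S(n,r)$, i.e. a strongly regular graph with parameters $\left(n,r,\frac{r(r-1)}{n-1},\frac{r(r-1)}{n-1}\right)$. Here an $r$-regular graph on $n$ vertices is called strongly regular with parameters $(n,r,a,c)$ if any two adjacent vertices have exactly $a$ common neighbours and any two distinct non-adjacent vertices have exactly $c$ common neighbours ($a,c$ being nonnegative integers). (2)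 If $n> \frac{8m^2}{2m+M_1}$, then $$QE(G)<\sqrt{\frac{2m+M_1-\frac{4m^2}{n}}{n}}+\sqrt{(n-1)\left(2m+M_1-\frac{4m^2}{n}-\frac{2m+M_1-\frac{4m^2}{n}}{n}\right)}.$$ -/

import Mathlib

noncomputable section

namespace SignlessEnergy

/-- The signless Laplacian matrix `Q(G) = D(G) + A(G)` of a finite simple graph. -/
def signlessLapMatrix {V : Type*} [Fintype V] [DecidableEq V]
    (G : SimpleGraph V) [DecidableRel G.Adj] : Matrix V V ℝ :=
  G.degMatrix ℝ + G.adjMatrix ℝ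

theorem isHermitian_signlessLapMatrix {V : Type*} [Fintype V] [DecidableEq V]
    (G : SimpleGraph V) [DecidableRel G.Adj] : (signlessLapMatrix G).IsHermitian := by
  have h : (signlessLapMatrix G).transpose = signlessLapMatrix G := by
    rw [signlessLapMatrix, Matrix.transpose_add, SimpleGraph.transpose_adjMatrix,
      SimpleGraph.degMatrix, Matrix.diagonal_transpose]
  rw [Matrix.IsHermitian, Matrix.conjTranspose_eq_transpose_of_trivial, h]

/-- The signless Laplacian energy `QE(G) = ∑ |qᵢ - 2m/n|`, the sum over the eigenvalues `qᵢ`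
of `Q(G)` with multiplicity. -/
def signlessEnergy {V : Type*} [Fintype V] [DecidableEq V]
    (G : SimpleGraph V) [DecidableRel G.Adj] : ℝ :=
  ∑ i, |(isHermitian_signlessLapMatrix G).eigenvalues i
    - 2 * (G.edgeFinset.card : ℝ) / (Fintype.card V : ℝ)|

/-- The first Zagreb index `M₁(G) = ∑ dᵥ²`. -/
def firstZagreb {V : Type*} [Fintype V] (G : SimpleGraph V) [DecidableRel G.Adj] : ℕ :=
  ∑ v, G.degree v ^ 2

/-- The disjoint union `kH` of `k` copies of a graph `H`. -/
def disjointCopies {W : Type*} (k : ℕ) (H : SimpleGraph W) : SimpleGraph (Fin k × W) where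
  Adj p q := p.1 = q.1 ∧ H.Adj p.2 q.2
  symm := ⟨fun _ _ h => ⟨h.1.symm, h.2.symm⟩⟩
  loopless := ⟨fun _ h => H.irrefl h.2⟩

/-- `G` is an `S(n,r)`: a strongly regular graph with parameters
`(n, r, r(r-1)/(n-1), r(r-1)/(n-1))`; in particular the quotient is a natural number. -/
def IsS {V : Type*} [Fintype V] [DecidableEq V] (G : SimpleGraph V) [DecidableRel G.Adj]
    (n r : ℕ) : Prop :=
  ∃ c : ℕ, (c : ℝ) = (r : ℝ) * ((r : ℝ) - 1) / ((n : ℝ) - 1) ∧ G.IsSRGWith n r c c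

end SignlessEnergy

end

/-!
Write `a = 2m/n` for the average degree, `γᵢ = qᵢ - a` and `S = ∑ γᵢ² = 2m + M₁ - 4m²/n`. Then
`∑ γᵢ = 0`, and `γᵢ ≥ -a` because `Q = D + A` is positive semidefinite. The hypotheses of the two
parts say that `S ≤ n a²` and `S > n a²`.

**First part.** The Rayleigh quotient of `Q` at the all-ones vector is `2a`, so the largest `γ`,
say `γ₀`, is at least `a` (`exists_max_eigenvalue`). Let `s ≥ 0` be given by
`(n - 1) s² = S - a²`; then `s ≤ a` and the bound is `a + (n - 1) s`. The identity
`2 s (a + (n - 1) s - QE) = ∑_{i ≠ 0} (|γᵢ| - s)² + (γ₀ - a) (γ₀ + a - 2 s)`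
proves the inequality and shows that in case of equality `γ₀ = a` and `|γᵢ| = s` for all other `i`
(`sum_abs_le_and_eq`).

If `γ₀ = a`, the all-ones vector is an eigenvector of `Q`, so `G` is regular, of degree `r = a`, and
the `γᵢ` are the eigenvalues of the adjacency matrix `A`. With `J` the all-ones matrix,
`N = A² - s² I - ((r² - s²)/n) J` is symmetric and `tr N² = 0`, so `N = 0`
(`adjMatrix_sq_of_eigenvalues`). The entries of this identity say that any two distinct vertices
have equally many common neighbours, and the diagonal determines that number. Conversely,
for an `S(n,r)` one has `(A - r) (A² - (r - c)) = 0`, so each `|γᵢ|` is a root of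
`(x - r) (x - √(r - c))`; summing over `i` yields the energy without computing any multiplicity
(`signlessEnergy_of_isS`). The graphs `Kₙ` and `(n/2) K₂` are themselves of the form `S(n,r)`.

**Second part.** Let `t = √(S/n) > a`; the bound is `n t`. Expanding `∑ (|γᵢ| - t)² ≥ 0` gives
`QE ≤ n t`. Equality would force `|γᵢ| = t` for all `i`, hence `γᵢ = t` since `γᵢ ≥ -a > -t`,
contradicting `∑ γᵢ = 0` (`sum_abs_lt`).
-/

/-! ### Polynomials in a real symmetric matrix -/

open Polynomial in
theorem Matrix.IsHermitian.aeval_eq_conj_diagonal {V : Type*} [Fintype V] [DecidableEq V]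
    {A : Matrix V V ℝ} (hA : A.IsHermitian) (p : ℝ[X]) :
    aeval A p = (hA.eigenvectorUnitary : Matrix V V ℝ)
      * Matrix.diagonal (fun i => p.eval (hA.eigenvalues i))
      * star (hA.eigenvectorUnitary : Matrix V V ℝ) := by
  have h := hA.spectral_theorem
  have h1 : aeval A p = Unitary.conjStarAlgAut ℝ _ hA.eigenvectorUnitary
      (aeval (Matrix.diagonal hA.eigenvalues) p) := by
    conv_lhs => rw [h]
    exact aeval_algHom_apply (Unitary.conjStarAlgAut ℝ _ hA.eigenvectorUnitary :
      Matrix V V ℝ ≃⋆ₐ[ℝ] Matrix V V ℝ) _ p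
  have h2 : aeval (Matrix.diagonal hA.eigenvalues) p
      = Matrix.diagonal (fun i => p.eval (hA.eigenvalues i)) := by
    have := aeval_algHom_apply (Matrix.diagonalAlgHom (n := V) (α := ℝ) ℝ) hA.eigenvalues p
    rw [Matrix.diagonalAlgHom_apply, Matrix.diagonalAlgHom_apply] at this
    rw [this]
    congr 1
    ext i
    rw [Polynomial.aeval_fn_apply]
    simp
  rw [h1, h2, Unitary.conjStarAlgAut_apply]

open Polynomial in
theorem Matrix.IsHermitian.trace_aeval {V : Type*} [Fintype V] [DecidableEq V]
    {A : Matrix V V ℝ} (hA : A.IsHermitian) (p : ℝ[X]) :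
    (aeval A p).trace = ∑ i, p.eval (hA.eigenvalues i) := by
  rw [hA.aeval_eq_conj_diagonal, Matrix.trace_mul_comm, ← mul_assoc, Unitary.coe_star_mul_self,
    one_mul, Matrix.trace_diagonal]

open Polynomial in
theorem Matrix.IsHermitian.eval_eigenvalues_eq_zero {V : Type*} [Fintype V] [DecidableEq V]
    {A : Matrix V V ℝ} (hA : A.IsHermitian) {p : ℝ[X]} (hp : aeval A p = 0) (i : V) :
    p.eval (hA.eigenvalues i) = 0 := by
  rw [hA.aeval_eq_conj_diagonal] at hp
  have h : Matrix.diagonal (fun i => p.eval (hA.eigenvalues i)) = 0 := by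
    calc _ = star (hA.eigenvectorUnitary : Matrix V V ℝ)
          * ((hA.eigenvectorUnitary : Matrix V V ℝ)
            * Matrix.diagonal (fun i => p.eval (hA.eigenvalues i))
            * star (hA.eigenvectorUnitary : Matrix V V ℝ))
          * (hA.eigenvectorUnitary : Matrix V V ℝ) := by
          rw [mul_assoc, mul_assoc, mul_assoc, Unitary.coe_star_mul_self, mul_one, ← mul_assoc,
            Unitary.coe_star_mul_self, one_mul]
      _ = 0 := by rw [hp, mul_zero, zero_mul]
  exact congrFun (Matrix.diagonal_eq_zero.mp h) i

open Polynomial in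
theorem Matrix.IsHermitian.posSemidef_smul_one_sub {V : Type*} [Fintype V] [DecidableEq V]
    {A : Matrix V V ℝ} (hA : A.IsHermitian) {x : ℝ} (hx : ∀ i, hA.eigenvalues i ≤ x) :
    (x • (1 : Matrix V V ℝ) - A).PosSemidef := by
  have h : x • (1 : Matrix V V ℝ) - A = aeval A (C x - X) := by
    rw [map_sub, aeval_X, aeval_C, Algebra.algebraMap_eq_smul_one]
  rw [h, hA.aeval_eq_conj_diagonal]
  have hd : (Matrix.diagonal fun i => (C x - X : ℝ[X]).eval (hA.eigenvalues i)).PosSemidef :=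
    Matrix.PosSemidef.diagonal fun i => by simpa using hx i
  exact hd.mul_mul_conjTranspose_same _

/-! ### Two extremal problems for `∑ |γᵢ|` with `∑ γᵢ²` prescribed -/

/-- If `∑ γᵢ²` is fixed and one entry is at least `a`, then `∑ |γᵢ|` is largest when that entry
equals `a` and all the others have the same absolute value `s`. The assumption `s ≤ a` is what makes
it unprofitable to increase the distinguished entry beyond `a`. -/
theorem sum_abs_le_and_eq {ι : Type*} [Fintype ι] [DecidableEq ι] (γ : ι → ℝ) (i₀ : ι) {a s : ℝ}
    (hs : 0 ≤ s) (hsa : s ≤ a) (ha : a ≤ γ i₀)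
    (hS : ((Fintype.card ι : ℝ) - 1) * s ^ 2 = ∑ i, γ i ^ 2 - a ^ 2) :
    ∑ i, |γ i| ≤ a + ((Fintype.card ι : ℝ) - 1) * s ∧
    (∑ i, |γ i| = a + ((Fintype.card ι : ℝ) - 1) * s →
      γ i₀ = a ∧ ∀ i, i ≠ i₀ → |γ i| = s) := by
  have hsq := Finset.add_sum_erase Finset.univ (fun i => γ i ^ 2) (Finset.mem_univ i₀)
  have habs := Finset.add_sum_erase Finset.univ (fun i => |γ i|) (Finset.mem_univ i₀)
  have hcard : (((Finset.univ.erase i₀).card : ℕ) : ℝ) = (Fintype.card ι : ℝ) - 1 := by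
    rw [Finset.card_erase_of_mem (Finset.mem_univ i₀), Finset.card_univ,
      Nat.cast_sub (Fintype.card_pos_iff.mpr ⟨i₀⟩), Nat.cast_one]
  have hdev : ∑ i ∈ Finset.univ.erase i₀, (|γ i| - s) ^ 2
      = ∑ i ∈ Finset.univ.erase i₀, γ i ^ 2 - 2 * s * ∑ i ∈ Finset.univ.erase i₀, |γ i|
        + ((Fintype.card ι : ℝ) - 1) * s ^ 2 := by
    rw [← hcard, ← nsmul_eq_mul, ← Finset.sum_const, Finset.mul_sum, ← Finset.sum_sub_distrib,
      ← Finset.sum_add_distrib]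
    refine Finset.sum_congr rfl fun i _ => ?_
    rw [← sq_abs (γ i)]
    ring
  have hg : |γ i₀| = γ i₀ := abs_of_nonneg (by linarith)
  simp only [hg] at habs
  have hdev0 : 0 ≤ ∑ i ∈ Finset.univ.erase i₀, (|γ i| - s) ^ 2 :=
    Finset.sum_nonneg fun i _ => sq_nonneg _
  -- The defect in the bound is a sum of two nonnegative terms.
  have key : 2 * s * (a + ((Fintype.card ι : ℝ) - 1) * s - ∑ i, |γ i|)
      = ∑ i ∈ Finset.univ.erase i₀, (|γ i| - s) ^ 2 + (γ i₀ - a) * (γ i₀ + a - 2 * s) := by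
    rw [hdev, ← habs]
    linear_combination hS - hsq
  have hprod : 0 ≤ (γ i₀ - a) * (γ i₀ + a - 2 * s) :=
    mul_nonneg (by linarith) (by linarith)
  have hdev_zero : ∑ i ∈ Finset.univ.erase i₀, (|γ i| - s) ^ 2 = 0 →
      ∀ i, i ≠ i₀ → |γ i| = s := by
    intro h i hi
    have := (Finset.sum_eq_zero_iff_of_nonneg fun i _ => sq_nonneg (|γ i| - s)).mp h i
      (Finset.mem_erase.mpr ⟨hi, Finset.mem_univ i⟩)
    exact sub_eq_zero.mp (pow_eq_zero_iff two_ne_zero |>.mp this)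
  rcases hs.eq_or_lt with rfl | hs'
  · -- For `s = 0` the sum `∑ |γᵢ|` drops out of `key`; here `γ i₀ ≥ a` exhausts `∑ γᵢ² = a²`.
    have hrest : 0 ≤ ∑ i ∈ Finset.univ.erase i₀, γ i ^ 2 :=
      Finset.sum_nonneg fun i _ => sq_nonneg _
    have h0 : γ i₀ = a := by nlinarith
    have hz := hdev_zero (by rw [hdev]; rw [h0] at hsq; nlinarith)
    have hT : ∑ i ∈ Finset.univ.erase i₀, |γ i| = 0 :=
      Finset.sum_eq_zero fun i hi => hz i (Finset.ne_of_mem_erase hi)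
    exact ⟨by rw [← habs, hT, h0]; simp, fun _ => ⟨h0, hz⟩⟩
  · refine ⟨?_, fun h => ?_⟩
    · by_contra! hlt
      nlinarith
    · rw [h, sub_self, mul_zero] at key
      have h1 : (γ i₀ - a) * (γ i₀ + a - 2 * s) = 0 := by linarith
      refine ⟨?_, hdev_zero (by linarith)⟩
      rcases mul_eq_zero.mp h1 with h2 | h2 <;> linarith

/-- The Cauchy-Schwarz bound `∑ |γᵢ| ≤ n t` with `n t² = ∑ γᵢ²` is strict if the `γᵢ` have sum zero
and all exceed `-t`: equality would make every `γᵢ` equal to `t`. -/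
theorem sum_abs_lt {ι : Type*} [Fintype ι] [Nonempty ι] (γ : ι → ℝ) {t : ℝ} (ht : 0 < t)
    (hlow : ∀ i, -t < γ i) (hsum : ∑ i, γ i = 0)
    (hS : (Fintype.card ι : ℝ) * t ^ 2 = ∑ i, γ i ^ 2) :
    ∑ i, |γ i| < (Fintype.card ι : ℝ) * t := by
  have hdev : ∑ i, (|γ i| - t) ^ 2
      = ∑ i, γ i ^ 2 - 2 * t * ∑ i, |γ i| + (Fintype.card ι : ℝ) * t ^ 2 := by
    rw [← Finset.card_univ, ← nsmul_eq_mul, ← Finset.sum_const, Finset.mul_sum,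
      ← Finset.sum_sub_distrib, ← Finset.sum_add_distrib]
    refine Finset.sum_congr rfl fun i _ => ?_
    rw [← sq_abs (γ i)]
    ring
  have hpos : 0 < ∑ i, (|γ i| - t) ^ 2 := by
    refine lt_of_le_of_ne (Finset.sum_nonneg fun i _ => sq_nonneg _) fun h => ?_
    have hall : ∀ i, γ i = t := fun i => by
      have h1 := (Finset.sum_eq_zero_iff_of_nonneg fun i _ => sq_nonneg (|γ i| - t)).mp h.symm i
        (Finset.mem_univ i)
      have h2 : |γ i| = t := sub_eq_zero.mp (pow_eq_zero_iff two_ne_zero |>.mp h1)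
      rcases eq_or_eq_neg_of_abs_eq h2 with h3 | h3
      · exact h3
      · exact absurd h3 (hlow i).ne'
    have : 0 < ∑ i, γ i := Finset.sum_pos (fun i _ => by rw [hall i]; exact ht)
      Finset.univ_nonempty
    exact this.ne' hsum
  by_contra! hle
  nlinarith

/-! ### The signless Laplacian spectrum -/

namespace SignlessEnergy

section

variable {V : Type*} [Fintype V] (G : SimpleGraph V) [DecidableRel G.Adj]

theorem sum_degrees_real : ∑ v, (G.degree v : ℝ) = 2 * (G.edgeFinset.card : ℝ) := by
  exact_mod_cast G.sum_degrees_eq_twice_card_edges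

variable {G} in
theorem adjMatrix_mul_ones_of_regular {r : ℕ} (hr : G.IsRegularOfDegree r) :
    G.adjMatrix ℝ * Matrix.of (fun _ _ : V => (1 : ℝ))
      = (r : ℝ) • Matrix.of (fun _ _ : V => (1 : ℝ)) := by
  ext v w
  rw [G.adjMatrix_mul_apply]
  simp [hr v]

variable {G} in
theorem two_mul_card_edgeFinset_div_of_regular [Nonempty V] {r : ℕ}
    (hr : G.IsRegularOfDegree r) : 2 * (G.edgeFinset.card : ℝ) / Fintype.card V = r := by
  have hn : (Fintype.card V : ℝ) ≠ 0 := by exact_mod_cast Fintype.card_ne_zero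
  rw [← sum_degrees_real, div_eq_iff hn]
  simp [hr.degree_eq, mul_comm]

variable [DecidableEq V]

theorem signlessLapMatrix_mulVec_one (v : V) :
    (signlessLapMatrix G).mulVec (fun _ => 1) v = 2 * (G.degree v : ℝ) := by
  rw [signlessLapMatrix, Matrix.add_mulVec, Pi.add_apply, G.degMatrix_mulVec_apply,
    G.adjMatrix_mulVec_apply]
  simp
  ring

/-- The quadratic form of `Q(G)` is the sum of `(xᵤ + xᵥ)²` over the edges `uv`. -/
theorem posSemidef_signlessLapMatrix : (signlessLapMatrix G).PosSemidef := by
  refine Matrix.PosSemidef.of_dotProduct_mulVec_nonneg (isHermitian_signlessLapMatrix G) fun x => ?_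
  have h : star x ⬝ᵥ (signlessLapMatrix G).mulVec x
      = (∑ i, ∑ j, if G.Adj i j then (x i + x j) ^ 2 else 0) / 2 := by
    have hsymm : (∑ i, ∑ j, if G.Adj i j then x j ^ 2 else 0)
        = ∑ i, ∑ j, if G.Adj i j then x i ^ 2 else 0 := by
      rw [Finset.sum_comm]
      simp only [G.adj_comm]
    have hsplit : (∑ i, ∑ j, if G.Adj i j then (x i + x j) ^ 2 else 0)
        = (∑ i, ∑ j, if G.Adj i j then x i ^ 2 else 0)
          + 2 * (∑ i, ∑ j, if G.Adj i j then x i * x j else 0)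
          + ∑ i, ∑ j, if G.Adj i j then x j ^ 2 else 0 := by
      simp only [Finset.mul_sum, ← Finset.sum_add_distrib]
      refine Finset.sum_congr rfl fun i _ => Finset.sum_congr rfl fun j _ => ?_
      split_ifs <;> ring
    rw [hsplit, hsymm, star_trivial, signlessLapMatrix, Matrix.add_mulVec, dotProduct_add,
      G.dotProduct_mulVec_degMatrix, G.dotProduct_mulVec_adjMatrix]
    have hd : ∑ i, (G.degree i : ℝ) * x i * x i = ∑ i, ∑ j, if G.Adj i j then x i ^ 2 else 0 := by
      refine Finset.sum_congr rfl fun i _ => ?_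
      rw [G.degree_eq_sum_if_adj, Finset.sum_mul, Finset.sum_mul]
      refine Finset.sum_congr rfl fun j _ => ?_
      split_ifs <;> ring
    rw [hd]
    ring
  rw [h]
  refine div_nonneg (Finset.sum_nonneg fun i _ => Finset.sum_nonneg fun j _ => ?_) zero_le_two
  split_ifs <;> positivity

theorem sum_eigenvalues :
    ∑ i, (isHermitian_signlessLapMatrix G).eigenvalues i = 2 * (G.edgeFinset.card : ℝ) := by
  have h := (isHermitian_signlessLapMatrix G).trace_eq_sum_eigenvalues
  simp only [RCLike.ofReal_real_eq_id, id] at h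
  rw [← h, signlessLapMatrix, Matrix.trace_add, SimpleGraph.trace_adjMatrix ℝ, SimpleGraph.degMatrix,
    Matrix.trace_diagonal, add_zero, sum_degrees_real]

theorem sum_sq_eigenvalues :
    ∑ i, (isHermitian_signlessLapMatrix G).eigenvalues i ^ 2
      = 2 * (G.edgeFinset.card : ℝ) + firstZagreb G := by
  have h := (isHermitian_signlessLapMatrix G).trace_aeval (Polynomial.X ^ 2)
  simp only [Polynomial.eval_pow, Polynomial.eval_X, map_pow, Polynomial.aeval_X] at h
  rw [← h, sq, ← sum_degrees_real, firstZagreb]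
  push_cast
  rw [← Finset.sum_add_distrib]
  refine Finset.sum_congr rfl fun v _ => ?_
  rw [Matrix.diag_apply, signlessLapMatrix, add_mul, mul_add, mul_add, Matrix.add_apply,
    Matrix.add_apply, Matrix.add_apply, G.adjMatrix_mul_self_apply_self, SimpleGraph.degMatrix,
    Matrix.diagonal_mul_diagonal, Matrix.diagonal_apply_eq, Matrix.diagonal_mul,
    Matrix.mul_diagonal]
  simp
  ring

/-- The largest eigenvalue of `Q(G)` is at least the Rayleigh quotient `4m/n` at the all-ones vector;
if the two agree, the all-ones vector is an eigenvector and `G` is regular. -/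
theorem exists_max_eigenvalue [Nonempty V] :
    ∃ i₀, 4 * (G.edgeFinset.card : ℝ) / Fintype.card V
        ≤ (isHermitian_signlessLapMatrix G).eigenvalues i₀ ∧
      ((isHermitian_signlessLapMatrix G).eigenvalues i₀
          = 4 * (G.edgeFinset.card : ℝ) / Fintype.card V →
        ∀ v, (G.degree v : ℝ) = 2 * (G.edgeFinset.card : ℝ) / Fintype.card V) := by
  obtain ⟨i₀, hi₀⟩ := Finite.exists_max (isHermitian_signlessLapMatrix G).eigenvalues
  set q := (isHermitian_signlessLapMatrix G).eigenvalues i₀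
  have hpsd := (isHermitian_signlessLapMatrix G).posSemidef_smul_one_sub hi₀
  have hmul : ∀ v, (q • (1 : Matrix V V ℝ) - signlessLapMatrix G).mulVec (fun _ => 1) v
      = q - 2 * (G.degree v : ℝ) := fun v => by
    rw [Matrix.sub_mulVec, Pi.sub_apply, signlessLapMatrix_mulVec_one, Matrix.smul_mulVec,
      Matrix.one_mulVec]
    simp
  have hn : (0 : ℝ) < Fintype.card V := by exact_mod_cast Fintype.card_pos
  have hquad : star (fun _ : V => (1 : ℝ)) ⬝ᵥ
      (q • (1 : Matrix V V ℝ) - signlessLapMatrix G).mulVec (fun _ => 1)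
      = Fintype.card V * q - 4 * (G.edgeFinset.card : ℝ) := by
    simp only [dotProduct, hmul, Pi.star_apply, star_trivial, one_mul, Finset.sum_sub_distrib,
      ← Finset.mul_sum, sum_degrees_real, Finset.sum_const, Finset.card_univ, nsmul_eq_mul]
    ring
  refine ⟨i₀, ?_, fun h v => ?_⟩
  · have := hpsd.dotProduct_mulVec_nonneg (fun _ => 1)
    rw [hquad] at this
    rw [div_le_iff₀ hn]
    linarith
  · have hz := (hpsd.dotProduct_mulVec_zero_iff (fun _ => 1)).mp
      (by rw [hquad]; change q = _ at h; rw [h]; field_simp; ring)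
    have hv := congrFun hz v
    rw [hmul v, Pi.zero_apply] at hv
    change q = _ at h
    rw [h] at hv
    field_simp at hv ⊢
    linarith

variable {G}

/-! ### Regular graphs whose adjacency matrix squares to a combination of `I` and `J` -/

theorem signlessLapMatrix_eq_of_regular {r : ℕ} (hr : G.IsRegularOfDegree r) :
    signlessLapMatrix G = (r : ℝ) • (1 : Matrix V V ℝ) + G.adjMatrix ℝ := by
  rw [signlessLapMatrix, SimpleGraph.degMatrix, Matrix.smul_one_eq_diagonal]
  congr 2
  ext v
  rw [hr v]

theorem adjMatrix_sq_apply (u v : V) :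
    (G.adjMatrix ℝ ^ 2) u v = Fintype.card (G.commonNeighbors u v) := by
  rw [SimpleGraph.adjMatrix_pow_apply_eq_card_walk,
    @Fintype.card_congr _ _ (G.fintypeSetWalkLength u v 2) _
      (G.walkLengthTwoEquivCommonNeighbors u v)]

open Polynomial in
theorem aeval_signlessLapMatrix_of_regular {r : ℕ} (hr : G.IsRegularOfDegree r) (t : ℝ) :
    aeval (signlessLapMatrix G) ((X - C (r : ℝ)) ^ 2 - C t)
      = G.adjMatrix ℝ ^ 2 - t • (1 : Matrix V V ℝ) := by
  rw [map_sub, map_pow, map_sub, aeval_X, aeval_C, aeval_C, signlessLapMatrix_eq_of_regular hr,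
    Algebra.algebraMap_eq_smul_one, Algebra.algebraMap_eq_smul_one, add_sub_cancel_left]

open Polynomial in
/-- If the adjacency matrix of an `r`-regular graph has one eigenvalue `r` and all others of absolute
value `s`, then `A² = s² I + c J` with `c = (r² - s²)/n`: the difference `N` of the two sides is
symmetric, and `tr N² = 0` follows from the spectrum of `A² - s² I` and `A J = r J`. -/
theorem adjMatrix_sq_of_eigenvalues [Nonempty V] {r : ℕ} (hr : G.IsRegularOfDegree r) {s : ℝ}
    {i₀ : V} (h0 : (isHermitian_signlessLapMatrix G).eigenvalues i₀ - r = r)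
    (hs : ∀ i, i ≠ i₀ → |(isHermitian_signlessLapMatrix G).eigenvalues i - r| = s) :
    G.adjMatrix ℝ ^ 2 = s ^ 2 • (1 : Matrix V V ℝ)
      + (((r : ℝ) ^ 2 - s ^ 2) / Fintype.card V) • Matrix.of (fun _ _ : V => (1 : ℝ)) := by
  have hn : (Fintype.card V : ℝ) ≠ 0 := by exact_mod_cast Fintype.card_ne_zero
  set J : Matrix V V ℝ := Matrix.of (fun _ _ : V => (1 : ℝ)) with hJ
  set A := G.adjMatrix ℝ with hA
  set M : Matrix V V ℝ := A ^ 2 - s ^ 2 • 1 with hM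
  set c : ℝ := ((r : ℝ) ^ 2 - s ^ 2) / Fintype.card V with hc
  have hMM : (M * M).trace = ((r : ℝ) ^ 2 - s ^ 2) ^ 2 := by
    have hp : aeval (signlessLapMatrix G) (((X - C (r : ℝ)) ^ 2 - C (s ^ 2)) ^ 2) = M * M := by
      rw [map_pow, aeval_signlessLapMatrix_of_regular hr, sq]
    rw [← hp, (isHermitian_signlessLapMatrix G).trace_aeval, Finset.sum_eq_single i₀]
    · simp only [eval_pow, eval_sub, eval_X, eval_C, h0]
    · intro i _ hi
      simp only [eval_pow, eval_sub, eval_X, eval_C, ← hs i hi, sq_abs, sub_self]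
      norm_num
    · exact fun h => absurd (Finset.mem_univ _) h
  have hMJ : M * J = ((r : ℝ) ^ 2 - s ^ 2) • J := by
    rw [hM, sub_mul, sq, mul_assoc, adjMatrix_mul_ones_of_regular hr, mul_smul_comm,
      adjMatrix_mul_ones_of_regular hr, smul_mul_assoc, one_mul, smul_smul, ← sub_smul]
    rw [← hJ, ← sq]
  have hJJ : J * J = (Fintype.card V : ℝ) • J := by
    ext u v
    simp [hJ, Matrix.mul_apply]
  have hJtr : J.trace = Fintype.card V := by simp [hJ, Matrix.trace]
  have hsymm : (M - c • J).conjTranspose = M - c • J := by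
    have hJt : J.transpose = J := by ext; simp [hJ]
    rw [Matrix.conjTranspose_eq_transpose_of_trivial, Matrix.transpose_sub, Matrix.transpose_smul,
      hJt, hM, Matrix.transpose_sub, Matrix.transpose_pow, G.transpose_adjMatrix,
      Matrix.transpose_smul, Matrix.transpose_one]
  have htr : ((M - c • J) * (M - c • J).conjTranspose).trace = 0 := by
    rw [hsymm, sub_mul, mul_sub M M, mul_sub (c • J), Matrix.trace_sub, Matrix.trace_sub, Matrix.trace_sub,
      hMM, smul_mul_assoc, smul_mul_assoc, mul_smul_comm, mul_smul_comm, Matrix.trace_smul,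
      Matrix.trace_smul, Matrix.trace_smul, Matrix.trace_smul, Matrix.trace_mul_comm J M, hMJ, hJJ,
      Matrix.trace_smul, Matrix.trace_smul, hJtr]
    simp only [smul_eq_mul, hc]
    field_simp
    ring
  have hN := Matrix.trace_mul_conjTranspose_self_eq_zero_iff.mp htr
  rw [← sub_eq_zero, ← sub_sub]
  exact hN

theorem adjMatrix_sq_of_isSRGWith {r c : ℕ} {n : ℕ} (h : G.IsSRGWith n r c c) :
    G.adjMatrix ℝ ^ 2 = ((r : ℝ) - c) • (1 : Matrix V V ℝ)
      + (c : ℝ) • Matrix.of (fun _ _ : V => (1 : ℝ)) := by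
  rw [h.matrix_eq]
  ext u v
  rw [Matrix.add_apply, Matrix.add_apply, Matrix.smul_apply, Matrix.smul_apply, Matrix.smul_apply]
  by_cases huv : u = v
  · subst huv; simp
  · by_cases ha : G.Adj u v <;> simp [huv, ha]

open Polynomial in
/-- For a strongly regular graph with parameters `(n, r, c, c)`, every eigenvalue of the adjacency
matrix has absolute value `r` or `√(r - c)`, as `(A - r) (A² - (r - c)) = (A - r) c J = 0`. -/
theorem abs_eigenvalue_of_isSRGWith {r c : ℕ} {n : ℕ} (h : G.IsSRGWith n r c c) {s : ℝ}
    (hs : 0 ≤ s) (hsq : s ^ 2 = r - c) (i : V) :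
    (|(isHermitian_signlessLapMatrix G).eigenvalues i - r| - r)
      * (|(isHermitian_signlessLapMatrix G).eigenvalues i - r| - s) = 0 := by
  have hp : aeval (signlessLapMatrix G)
      ((X - C (r : ℝ) - C (r : ℝ)) * ((X - C (r : ℝ)) ^ 2 - C (s ^ 2))) = 0 := by
    rw [map_mul, aeval_signlessLapMatrix_of_regular h.regular, adjMatrix_sq_of_isSRGWith h, hsq,
      add_sub_cancel_left, map_sub, map_sub, aeval_X, aeval_C,
      signlessLapMatrix_eq_of_regular h.regular, Algebra.algebraMap_eq_smul_one,
      add_sub_cancel_left, mul_smul_comm, sub_mul, adjMatrix_mul_ones_of_regular h.regular,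
      smul_mul_assoc, one_mul, sub_self, smul_zero]
  have hi := (isHermitian_signlessLapMatrix G).eval_eigenvalues_eq_zero hp i
  simp only [eval_mul, eval_sub, eval_pow, eval_X, eval_C] at hi
  rcases mul_eq_zero.mp hi with h1 | h1
  · rw [sub_eq_zero.mp h1, abs_of_nonneg (Nat.cast_nonneg r), sub_self, zero_mul]
  · rw [(sq_eq_sq₀ (abs_nonneg _) hs).mp ((sq_abs _).trans (sub_eq_zero.mp h1)), sub_self,
      mul_zero]

/-! ### The extremal graphs -/

theorem sum_sq_eigenvalues_sub [Nonempty V] :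
    ∑ i, ((isHermitian_signlessLapMatrix G).eigenvalues i
        - 2 * (G.edgeFinset.card : ℝ) / Fintype.card V) ^ 2
      = 2 * (G.edgeFinset.card : ℝ) + firstZagreb G
        - 4 * (G.edgeFinset.card : ℝ) ^ 2 / Fintype.card V := by
  have hn : (Fintype.card V : ℝ) ≠ 0 := by exact_mod_cast Fintype.card_ne_zero
  simp only [sub_sq, Finset.sum_add_distrib, Finset.sum_sub_distrib, ← Finset.sum_mul,
    ← Finset.mul_sum, sum_sq_eigenvalues, sum_eigenvalues, Finset.sum_const, Finset.card_univ,
    nsmul_eq_mul]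
  field_simp
  ring

theorem sum_eigenvalues_sub [Nonempty V] :
    ∑ i, ((isHermitian_signlessLapMatrix G).eigenvalues i
        - 2 * (G.edgeFinset.card : ℝ) / Fintype.card V) = 0 := by
  have hn : (Fintype.card V : ℝ) ≠ 0 := by exact_mod_cast Fintype.card_ne_zero
  rw [Finset.sum_sub_distrib, sum_eigenvalues, Finset.sum_const, Finset.card_univ, nsmul_eq_mul,
    mul_div_cancel₀ _ hn, sub_self]

theorem exists_isS_of_eigenvalues [Nontrivial V]
    (hdeg : ∀ v, (G.degree v : ℝ) = 2 * (G.edgeFinset.card : ℝ) / Fintype.card V) {s : ℝ} {i₀ : V}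
    (h0 : (isHermitian_signlessLapMatrix G).eigenvalues i₀
        - 2 * (G.edgeFinset.card : ℝ) / Fintype.card V
      = 2 * (G.edgeFinset.card : ℝ) / Fintype.card V)
    (hs : ∀ i, i ≠ i₀ → |(isHermitian_signlessLapMatrix G).eigenvalues i
      - 2 * (G.edgeFinset.card : ℝ) / Fintype.card V| = s) :
    ∃ r : ℕ, IsS G (Fintype.card V) r := by
  have hn : (1 : ℝ) < Fintype.card V := by exact_mod_cast Fintype.one_lt_card
  have hr : G.IsRegularOfDegree (G.degree i₀) := fun v => by
    exact_mod_cast (hdeg v).trans (hdeg i₀).symm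
  rw [← hdeg i₀] at h0
  simp only [← hdeg i₀] at hs
  have hA := adjMatrix_sq_of_eigenvalues hr h0 hs
  set x : ℝ := ((G.degree i₀ : ℝ) ^ 2 - s ^ 2) / Fintype.card V with hx
  have hoff : ∀ u v, u ≠ v → (Fintype.card (G.commonNeighbors u v) : ℝ) = x := fun u v huv => by
    rw [← adjMatrix_sq_apply, hA]
    simp [Matrix.one_apply_ne huv]
  have hdiag : (G.degree i₀ : ℝ) = s ^ 2 + x := by
    have h := congrFun (congrFun hA i₀) i₀
    rw [sq, G.adjMatrix_mul_self_apply_self] at h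
    simpa using h
  obtain ⟨u, v, huv⟩ := exists_pair_ne V
  have hc := hoff u v huv
  refine ⟨G.degree i₀, Fintype.card (G.commonNeighbors u v), ?_, rfl, hr, ?_, ?_⟩
  · rw [hc, eq_div_iff (by linarith)]
    rw [eq_div_iff (by linarith)] at hx
    linear_combination hx + hdiag
  · intro w z hwz
    exact_mod_cast (hoff w z hwz.ne).trans hc.symm
  · intro w z hwz _
    exact_mod_cast (hoff w z hwz).trans hc.symm

theorem signlessEnergy_of_isS [Nontrivial V] (hm : 1 ≤ G.edgeFinset.card) {r : ℕ}
    (h : IsS G (Fintype.card V) r) :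
    signlessEnergy G = 2 * (G.edgeFinset.card : ℝ) / Fintype.card V
      + Real.sqrt (((Fintype.card V : ℝ) - 1)
          * (2 * (G.edgeFinset.card : ℝ) + firstZagreb G
            - 4 * (G.edgeFinset.card : ℝ) ^ 2 / Fintype.card V
            - (2 * (G.edgeFinset.card : ℝ) / Fintype.card V) ^ 2)) := by
  obtain ⟨c, hc, h⟩ := h
  have hn : (1 : ℝ) < Fintype.card V := by exact_mod_cast Fintype.one_lt_card
  have hr := two_mul_card_edgeFinset_div_of_regular h.regular
  have hr0 : (0 : ℝ) < r := by
    rw [← hr]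
    have : (1 : ℝ) ≤ G.edgeFinset.card := by exact_mod_cast hm
    positivity
  have h2m : 2 * (G.edgeFinset.card : ℝ) = Fintype.card V * r := by
    rw [← hr, mul_div_cancel₀ _ (by linarith)]
  have hM : (firstZagreb G : ℝ) = Fintype.card V * (r : ℝ) ^ 2 := by
    simp [firstZagreb, h.regular.degree_eq]
  have hcr : (c : ℝ) ≤ r := by
    have hlt : (r : ℝ) + 1 ≤ Fintype.card V := by
      obtain ⟨v⟩ : Nonempty V := inferInstance
      have := G.degree_lt_card_verts v
      rw [h.regular v] at this
      exact_mod_cast this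
    rw [hc, div_le_iff₀ (by linarith)]
    nlinarith
  rw [eq_div_iff (by linarith)] at hc
  set s := Real.sqrt ((r : ℝ) - c)
  have hs0 : 0 ≤ s := Real.sqrt_nonneg _
  have hsq : s ^ 2 = r - c := Real.sq_sqrt (by linarith)
  have h4 : 4 * (G.edgeFinset.card : ℝ) ^ 2 / Fintype.card V = Fintype.card V * (r : ℝ) ^ 2 := by
    rw [div_eq_iff (by linarith)]
    linear_combination (2 * (G.edgeFinset.card : ℝ) + Fintype.card V * r) * h2m
  -- Each `x = |γᵢ|` satisfies `(x - r) (x - s) = 0`, so `(r + s) x = x² + r s`; sum over `i`.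
  have hE : (r + s) * signlessEnergy G = Fintype.card V * r + Fintype.card V * (r * s) := by
    have hsum := sum_sq_eigenvalues_sub (G := G)
    rw [hr, hM] at hsum
    rw [h4, add_sub_cancel_right, h2m] at hsum
    rw [signlessEnergy, hr, ← hsum, Finset.mul_sum, ← Finset.card_univ, ← nsmul_eq_mul,
      ← Finset.sum_const, ← Finset.sum_add_distrib]
    refine Finset.sum_congr rfl fun i _ => ?_
    rw [← sq_abs]
    linear_combination -(abs_eigenvalue_of_isSRGWith h hs0 hsq i)
  have hsqrt : Real.sqrt (((Fintype.card V : ℝ) - 1)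
      * (2 * (G.edgeFinset.card : ℝ) + firstZagreb G
        - 4 * (G.edgeFinset.card : ℝ) ^ 2 / Fintype.card V
        - (2 * (G.edgeFinset.card : ℝ) / Fintype.card V) ^ 2)) = ((Fintype.card V : ℝ) - 1) * s := by
    rw [hr, h4, h2m, hM, ← Real.sqrt_sq (mul_nonneg (sub_nonneg.mpr hn.le) hs0)]
    congr 1
    linear_combination (1 - (Fintype.card V : ℝ)) * (Fintype.card V - 1) * hsq
      + (Fintype.card V - 1) * hc
  rw [hsqrt, hr]
  have hrs : (r : ℝ) + s ≠ 0 := by positivity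
  apply mul_left_cancel₀ hrs
  rw [hE]
  linear_combination (1 - (Fintype.card V : ℝ)) * hsq + hc

theorem isS_of_iso_top [Nontrivial V] {n : ℕ} (hn : Fintype.card V = n)
    (φ : G ≃g (⊤ : SimpleGraph (Fin n))) : IsS G n (n - 1) := by
  subst hn
  have hG : G = ⊤ := by
    ext u v
    rw [← φ.map_adj_iff, SimpleGraph.top_adj, SimpleGraph.top_adj, φ.injective.ne_iff]
  have hn : 1 < Fintype.card V := Fintype.one_lt_card
  refine ⟨Fintype.card V - 2, ?_, ?_⟩
  · have hn' : (1 : ℝ) < Fintype.card V := by exact_mod_cast hn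
    rw [eq_div_iff (by linarith), Nat.cast_sub hn, Nat.cast_sub hn.le]
    push_cast
    ring
  · subst hG
    convert SimpleGraph.IsSRGWith.top (V := V) (μ := Fintype.card V - 2)

theorem isS_of_iso_disjointCopies {n k : ℕ} (hn : Fintype.card V = n)
    (φ : G ≃g disjointCopies k (⊤ : SimpleGraph (Fin 2))) : IsS G n 1 := by
  have huniq : ∀ v, ∃! w, G.Adj v w := by
    intro v
    have hp : ∃! p, (disjointCopies k (⊤ : SimpleGraph (Fin 2))).Adj (φ v) p := by
      obtain ⟨i, x⟩ := φ v
      refine ⟨(i, 1 - x), ⟨rfl, ?_⟩, ?_⟩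
      · change x ≠ 1 - x
        fin_cases x <;> decide
      · rintro ⟨j, y⟩ ⟨rfl, hxy⟩
        change x ≠ y at hxy
        have : y = 1 - x := by revert hxy; revert x y; decide
        rw [this]
    obtain ⟨p, hp1, hp2⟩ := hp
    refine ⟨φ.symm p, ?_, fun w hw => ?_⟩
    · exact φ.map_adj_iff.mp (by rwa [φ.apply_symm_apply])
    · rw [← hp2 (φ w) (φ.map_adj_iff.mpr hw), φ.symm_apply_apply]
  have hempty : ∀ u v, u ≠ v → Fintype.card (G.commonNeighbors u v) = 0 := by
    intro u v huv
    rw [Fintype.card_eq_zero_iff]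
    exact ⟨fun ⟨w, hu, hv⟩ => huv ((huniq w).unique hu.symm hv.symm)⟩
  exact ⟨0, by simp, hn, fun v => SimpleGraph.degree_eq_one_iff_existsUnique_adj.mpr (huniq v),
    fun u v h => hempty u v h.ne, fun u v h _ => hempty u v h⟩

end

end SignlessEnergy

theorem theorem3 {V : Type*} [Fintype V] [DecidableEq V] (G : SimpleGraph V)
    [DecidableRel G.Adj] (n m M₁ : ℕ) (hn : Fintype.card V = n)
    (hm : G.edgeFinset.card = m) (hM : SignlessEnergy.firstZagreb G = M₁) (hm1 : 1 ≤ m) :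
    ((n : ℝ) ≤ 8 * (m : ℝ) ^ 2 / (2 * m + M₁) →
      SignlessEnergy.signlessEnergy G ≤ 2 * (m : ℝ) / n
          + Real.sqrt (((n : ℝ) - 1)
              * (2 * m + M₁ - 4 * (m : ℝ) ^ 2 / n - (2 * (m : ℝ) / n) ^ 2)) ∧
      (SignlessEnergy.signlessEnergy G = 2 * (m : ℝ) / n
          + Real.sqrt (((n : ℝ) - 1)
              * (2 * m + M₁ - 4 * (m : ℝ) ^ 2 / n - (2 * (m : ℝ) / n) ^ 2)) ↔
        Nonempty (G ≃g (⊤ : SimpleGraph (Fin n))) ∨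
        (∃ k : ℕ, n = 2 * k ∧
          Nonempty (G ≃g SignlessEnergy.disjointCopies k (⊤ : SimpleGraph (Fin 2)))) ∨
        (∃ r : ℕ, SignlessEnergy.IsS G n r))) ∧
    ((n : ℝ) > 8 * (m : ℝ) ^ 2 / (2 * m + M₁) →
      SignlessEnergy.signlessEnergy G <
        Real.sqrt ((2 * m + M₁ - 4 * (m : ℝ) ^ 2 / n) / n)
          + Real.sqrt (((n : ℝ) - 1)
              * (2 * m + M₁ - 4 * (m : ℝ) ^ 2 / n
                  - (2 * m + M₁ - 4 * (m : ℝ) ^ 2 / n) / n))) := by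
  subst hn hm hM
  have hnt : Nontrivial V := by
    by_contra hV
    rw [not_nontrivial_iff_subsingleton] at hV
    have h0 : G.edgeFinset.card = 0 := by
      rw [Finset.card_eq_zero, SimpleGraph.edgeFinset_eq_empty]
      exact Subsingleton.elim _ _
    omega
  have hn : (1 : ℝ) < Fintype.card V := by exact_mod_cast Fintype.one_lt_card
  have hmpos : (1 : ℝ) ≤ G.edgeFinset.card := by exact_mod_cast hm1
  have hMnn : (0 : ℝ) ≤ SignlessEnergy.firstZagreb G := Nat.cast_nonneg _
  have hS := SignlessEnergy.sum_sq_eigenvalues_sub (G := G)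
  have hsum := SignlessEnergy.sum_eigenvalues_sub (G := G)
  obtain ⟨i₀, hi₀, hreg⟩ := SignlessEnergy.exists_max_eigenvalue G
  set a : ℝ := 2 * (G.edgeFinset.card : ℝ) / Fintype.card V with ha
  set S : ℝ := 2 * (G.edgeFinset.card : ℝ) + SignlessEnergy.firstZagreb G
        - 4 * (G.edgeFinset.card : ℝ) ^ 2 / Fintype.card V with hSdef
  have ha0 : 0 < a := by positivity
  have h2a : 4 * (G.edgeFinset.card : ℝ) / Fintype.card V = a + a := by rw [ha]; ring
  rw [h2a] at hi₀ hreg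
  -- The condition separating the two parts compares `S` with `n a²`.
  have hcond : (Fintype.card V : ℝ) * (S - Fintype.card V * a ^ 2)
      = Fintype.card V * (2 * G.edgeFinset.card + SignlessEnergy.firstZagreb G)
        - 8 * (G.edgeFinset.card : ℝ) ^ 2 := by
    rw [hSdef, ha]
    field_simp
    ring
  constructor
  · intro h
    rw [le_div_iff₀ (by linarith)] at h
    have hSle : S ≤ Fintype.card V * a ^ 2 := by nlinarith
    have hSge : a ^ 2 ≤ S := by
      rw [← hS]
      refine le_trans ?_ (Finset.single_le_sum
        (f := fun i => ((SignlessEnergy.isHermitian_signlessLapMatrix G).eigenvalues i - a) ^ 2)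
        (fun i _ => sq_nonneg _) (Finset.mem_univ i₀))
      exact pow_le_pow_left₀ ha0.le (by linarith) 2
    set s : ℝ := Real.sqrt ((S - a ^ 2) / ((Fintype.card V : ℝ) - 1)) with hsdef
    have hs0 : 0 ≤ s := Real.sqrt_nonneg _
    have hs : ((Fintype.card V : ℝ) - 1) * s ^ 2 = S - a ^ 2 := by
      rw [hsdef, Real.sq_sqrt (div_nonneg (by linarith) (by linarith)),
        mul_div_cancel₀ _ (by linarith)]
    have hsa : s ≤ a := by
      refine Real.sqrt_le_iff.mpr ⟨ha0.le, ?_⟩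
      rw [div_le_iff₀ (by linarith)]
      linarith
    have hsqrt : Real.sqrt (((Fintype.card V : ℝ) - 1) * (S - a ^ 2))
        = ((Fintype.card V : ℝ) - 1) * s := by
      rw [← hs, show ((Fintype.card V : ℝ) - 1) * (((Fintype.card V : ℝ) - 1) * s ^ 2)
        = (((Fintype.card V : ℝ) - 1) * s) ^ 2 by ring,
        Real.sqrt_sq (mul_nonneg (by linarith) hs0)]
    obtain ⟨hle, heq⟩ := sum_abs_le_and_eq
      (fun i => (SignlessEnergy.isHermitian_signlessLapMatrix G).eigenvalues i - a) i₀ hs0 hsa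
      (by linarith) (by rw [hS, hs])
    rw [hsqrt]
    refine ⟨hle, fun hE => ?_, fun hG => ?_⟩
    · obtain ⟨h0, hrest⟩ := heq hE
      exact Or.inr (Or.inr (SignlessEnergy.exists_isS_of_eigenvalues
        (hreg (by linarith)) h0 hrest))
    · have hIsS : ∃ r, SignlessEnergy.IsS G (Fintype.card V) r := by
        rcases hG with ⟨⟨φ⟩⟩ | ⟨k, -, ⟨φ⟩⟩ | hr
        · exact ⟨_, SignlessEnergy.isS_of_iso_top rfl φ⟩
        · exact ⟨_, SignlessEnergy.isS_of_iso_disjointCopies rfl φ⟩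
        · exact hr
      obtain ⟨r, hr⟩ := hIsS
      rw [SignlessEnergy.signlessEnergy_of_isS hm1 hr, ← hsqrt]
  · intro h
    rw [gt_iff_lt, div_lt_iff₀ (by linarith)] at h
    have hSgt : Fintype.card V * a ^ 2 < S := by nlinarith
    set t : ℝ := Real.sqrt (S / Fintype.card V) with htdef
    have hat : a < t := by
      refine Real.lt_sqrt_of_sq_lt ?_
      rw [lt_div_iff₀ (by linarith)]
      linarith
    have ht : (Fintype.card V : ℝ) * t ^ 2 = S := by
      rw [htdef, Real.sq_sqrt (div_nonneg (le_trans (by positivity) hSgt.le) (by linarith)),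
        mul_div_cancel₀ _ (by linarith)]
    have hsqrt : Real.sqrt (((Fintype.card V : ℝ) - 1) * (S - S / Fintype.card V))
        = ((Fintype.card V : ℝ) - 1) * t := by
      rw [← ht, mul_div_cancel_left₀ _ (by linarith),
        show ((Fintype.card V : ℝ) - 1) * (Fintype.card V * t ^ 2 - t ^ 2)
          = (((Fintype.card V : ℝ) - 1) * t) ^ 2 by ring,
        Real.sqrt_sq (mul_nonneg (by linarith) (by linarith))]
    rw [hsqrt]
    have hlt := sum_abs_lt
      (fun i => (SignlessEnergy.isHermitian_signlessLapMatrix G).eigenvalues i - a)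
      (ha0.trans hat)
      (fun i => by
        have := (SignlessEnergy.posSemidef_signlessLapMatrix G).eigenvalues_nonneg i
        linarith)
      hsum (by rw [hS, ht])
    refine lt_of_lt_of_eq hlt ?_
    ring
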